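/- For $n\ge 1$ and $\gamma\in(0,1/2)$ let $\mathrm{GH}_{n,\gamma}$ be the gap-Hamming promise problem on $\{0,1\}^n\times\{0,1\}^n$: $\mathrm{GH}_{n,\gamma}(x,y)=1$ if the Hamming distance satisfies $d_H(x,y)\ge(\tfrac12+\gamma)n$, $\mathrm{GH}_{n,\gamma}(x,y)=0$ if $d_H(x,y)\le(\tfrac12-\gamma)n$, and it is undefined otherwise. For $f:\{0,1\}^p\to\{0,1\}$ let $f\circ \mathrm{GH}_{n,\gamma}^{\,p}$ be the partial function $(x,y)\mapsto f\big(\mathrm{GH}_{n,\gamma}(x_1,y_1),\dots,\mathrm{GH}_{n,\gamma}(x_p,y_p)\big)$ on $(\{0,1\}^n)^p\times(\{0,1\}^n)^p$, defined where all $\mathrm{GH}_{n,\gamma}(x_i,y_i)$ are. Let $D^{dt}(f)$ be the least height of a deterministic decision tree that computes $f$, and let $D^{cc}(F)$ be the least height of a deterministic two-party communication protocol tree (one bit sent by Alice or Bob at each internal node) that computes the partial function $F$ correctly on every input in its domain. There are an absolute constant $C>0$ and an integer $N$ such that for every even integer $n\ge N$, every non-negative integer $p\le 2^{n/200}$ and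 every function $f:\{0,1\}^p\to\{0,1\}$, $$D^{dt}(f)\;\le\; C\cdot\frac1n\cdot D^{cc}\big(f\circ \mathrm{GH}_{n,1/4}^{\,p}\big).$$ -/

import Mathlib

namespace Lifting

/-- Deterministic decision trees over the variables `z_i`, `i : Fin p`, with outputs in `Z`.
A node `query i t₀ t₁` queries `z_i` and continues in `t₀` if `z_i = 0` and in `t₁` if `z_i = 1`. -/
inductive DecisionTree (p : ℕ) (Z : Type) : Type
  | leaf (out : Z) : DecisionTree p Z
  | query (i : Fin p) (t₀ t₁ : DecisionTree p Z) : DecisionTree p Z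

namespace DecisionTree

variable {p : ℕ} {Z : Type}

/-- The output of the tree on the input `z`. -/
def eval : DecisionTree p Z → (Fin p → Bool) → Z
  | leaf out, _ => out
  | query i t₀ t₁, z => if z i = true then t₁.eval z else t₀.eval z

/-- The height (query complexity) of the tree, the number of queries on a longest path. -/
def height : DecisionTree p Z → ℕ
  | leaf _ => 0
  | query _ t₀ t₁ => max t₀.height t₁.height + 1

/-- The tree correctly computes `f` on every input. -/
def Computes (T : DecisionTree p Z) (f : (Fin p → Bool) → Z) : Prop :=
  ∀ z, T.eval z = f z

/-- Every function on the cube is computed by some decision tree. -/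
theorem exists_computes (f : (Fin p → Bool) → Z) :
    ∃ T : DecisionTree p Z, T.Computes f := by
  have key : ∀ (S : Finset (Fin p)) (f : (Fin p → Bool) → Z),
      (∀ z z', (∀ i ∈ S, z i = z' i) → f z = f z') →
      ∃ T : DecisionTree p Z, T.Computes f := by
    intro S
    induction S using Finset.induction_on with
    | empty =>
      intro f hf
      exact ⟨leaf (f fun _ => false), fun z => hf _ _ (by simp)⟩
    | insert i S _ ih =>
      intro f hf
      have h : ∀ b : Bool, ∃ T : DecisionTree p Z,
          T.Computes fun z => f (Function.update z i b) := by
        intro b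
        apply ih
        intro z z' hz
        apply hf
        intro j _
        by_cases hji : j = i
        · subst hji; simp
        · simp only [Function.update_of_ne hji]
          exact hz j (by simp_all)
      obtain ⟨T₀, h₀⟩ := h false
      obtain ⟨T₁, h₁⟩ := h true
      refine ⟨query i T₀ T₁, fun z => ?_⟩
      cases hb : z i with
      | false =>
        have := h₀ z
        simp only [← hb, Function.update_eq_self] at this
        simpa [eval, hb] using this
      | true =>
        have := h₁ z
        simp only [← hb, Function.update_eq_self] at this
        simpa [eval, hb] using this
  exact key Finset.univ f fun z z' h => congrArg f (funext fun i => h i (Finset.mem_univ i))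

end DecisionTree

/-- The deterministic query complexity of `f`, the least height of a decision tree that correctly
computes `f` on every input. -/
noncomputable def Ddt {p : ℕ} {Z : Type} (f : (Fin p → Bool) → Z) : ℕ :=
  sInf {d | ∃ T : DecisionTree p Z, T.Computes f ∧ T.height = d}

/-- Deterministic two-party protocols with inputs in `A` (Alice) and `B` (Bob) and outputs in `Z`.
At a node `alice s π₀ π₁` Alice, holding `a`, sends the bit `s a`, and the execution continues in
`π₀` if the bit is `0` and in `π₁` if it is `1`; likewise for Bob. -/
inductive Protocol (A B Z : Type) : Type
  | leaf (out : Z) : Protocol A B Z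
  | alice (s : A → Bool) (π₀ π₁ : Protocol A B Z) : Protocol A B Z
  | bob (s : B → Bool) (π₀ π₁ : Protocol A B Z) : Protocol A B Z

namespace Protocol

variable {A B Z : Type}

/-- The output of the protocol on the input `(a, b)`. -/
def eval : Protocol A B Z → A → B → Z
  | leaf out, _, _ => out
  | alice s π₀ π₁, a, b => if s a = true then π₁.eval a b else π₀.eval a b
  | bob s π₀ π₁, a, b => if s b = true then π₁.eval a b else π₀.eval a b

/-- The height (communication complexity) of the protocol, the number of bits exchanged on a
longest path. -/
def height : Protocol A B Z → ℕ
  | leaf _ => 0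
  | alice _ π₀ π₁ => max π₀.height π₁.height + 1
  | bob _ π₀ π₁ => max π₀.height π₁.height + 1

/-- The protocol correctly computes the partial function `F` (undefined where its value is `none`)
on every input in the domain of `F`; nothing is required outside the domain. -/
def Computes (π : Protocol A B Z) (F : A → B → Option Z) : Prop :=
  ∀ a b w, F a b = some w → π.eval a b = w

/-- Every partial function on finite sets is computed by some protocol. -/
theorem exists_computes [Finite A] [Finite B] [Nonempty Z] (F : A → B → Option Z) :
    ∃ π : Protocol A B Z, π.Computes F := by
  classical
  obtain ⟨z₀⟩ := ‹Nonempty Z›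
  have hB : ∀ (a : A) (S : Finset B), ∃ π : Protocol A B Z,
      ∀ a', ∀ b ∈ S, π.eval a' b = (F a b).getD z₀ := by
    intro a S
    induction S using Finset.induction_on with
    | empty => exact ⟨leaf z₀, by simp⟩
    | insert b₀ S _ ih =>
      obtain ⟨π, hπ⟩ := ih
      refine ⟨bob (fun b => decide (b = b₀)) π (leaf ((F a b₀).getD z₀)), fun a' b hb => ?_⟩
      by_cases h : b = b₀
      · simp [eval, h]
      · have : b ∈ S := by simpa [h] using hb
        simp [eval, h, hπ a' b this]
  have hA : ∀ S : Finset A, ∃ π : Protocol A B Z,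
      ∀ a ∈ S, ∀ b, π.eval a b = (F a b).getD z₀ := by
    intro S
    induction S using Finset.induction_on with
    | empty => exact ⟨leaf z₀, by simp⟩
    | insert a₀ S _ ih =>
      obtain ⟨π, hπ⟩ := ih
      have := Fintype.ofFinite B
      obtain ⟨ρ, hρ⟩ := hB a₀ Finset.univ
      refine ⟨alice (fun a => decide (a = a₀)) π ρ, fun a ha b => ?_⟩
      by_cases h : a = a₀
      · simp [eval, h, hρ a₀ b (Finset.mem_univ b)]
      · have : a ∈ S := by simpa [h] using ha
        simp [eval, h, hπ a this b]
  have := Fintype.ofFinite A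
  obtain ⟨π, hπ⟩ := hA Finset.univ
  exact ⟨π, fun a b w h => by rw [hπ a (Finset.mem_univ a) b, h]; rfl⟩

end Protocol

/-- The deterministic communication complexity of the partial function `F`, the least height of a
protocol that correctly computes `F` on its domain. -/
noncomputable def Dcc {A B Z : Type} (F : A → B → Option Z) : ℕ :=
  sInf {c | ∃ π : Protocol A B Z, π.Computes F ∧ π.height = c}

/-- The composition `f ∘ g^p` with a partial gadget `g`, that is
`(x, y) ↦ f (g (x_1, y_1), …, g (x_p, y_p))`; it is undefined where some `g (x_i, y_i)` is. -/
def compose {p : ℕ} {A B Z : Type} (f : (Fin p → Bool) → Z) (g : A → B → Option Bool)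
    (x : Fin p → A) (y : Fin p → B) : Option Z :=
  if h : ∀ i, (g (x i) (y i)).isSome = true then
    some (f fun i => (g (x i) (y i)).get (h i))
  else none

/-- `f ∘ g^p` takes the value `w` at `(x, y)` iff all `g (x_i, y_i)` are defined, and `f` takes the
value `w` at the string that they form. -/
theorem compose_eq_some_iff {p : ℕ} {A B Z : Type} (f : (Fin p → Bool) → Z)
    (g : A → B → Option Bool) (x : Fin p → A) (y : Fin p → B) (w : Z) :
    compose f g x y = some w ↔
      ∃ z : Fin p → Bool, (∀ i, g (x i) (y i) = some (z i)) ∧ f z = w := by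
  unfold compose
  constructor
  · intro h
    split_ifs at h with h'
    exact ⟨fun i => (g (x i) (y i)).get (h' i), fun i => by simp, by simpa using h⟩
  · rintro ⟨z, hz, rfl⟩
    have h' : ∀ i, (g (x i) (y i)).isSome = true := fun i => by simp [hz i]
    rw [dif_pos h']
    congr 2
    funext i
    simp [hz i]

/-- The gap-Hamming promise problem `GH_{n,γ}`: the value is `1` at Hamming distance at least
`(1/2 + γ) n` and `0` at Hamming distance at most `(1/2 - γ) n`; it is undefined elsewhere. -/
noncomputable def GH (n : ℕ) (γ : ℝ) (x y : Fin n → Bool) : Option Bool :=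
  if (1 / 2 + γ) * (n : ℝ) ≤ (hammingDist x y : ℝ) then some true
  else if (hammingDist x y : ℝ) ≤ (1 / 2 - γ) * (n : ℝ) then some false
  else none

end Lifting

/-! The proof is a simulation argument with hitting rectangles. For each value `b`, gap-Hamming has
a family of `b`-monochromatic rectangles, products of Hamming balls of radius `n / 8` whose centres
are equal or antipodal. By concentration of measure a random one meets any row or column set of
density `(1000/1007)^n` with probability at least 3/4 (`exists_hittingRectangles_GH`).

A decision tree simulates the protocol while keeping a rectangle `A × B` that is thick on the set
`I` of unqueried coordinates: however the other coordinates in `I` are fixed inside `A`, coordinate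
`i` takes no value or at least `m` values; likewise for `B`. If the speaker's set has large average
degree in every direction, the tree follows the likelier bit without a query, and thickness is
restored by pruning, which costs at most a factor 4 in size (`Thick.exists_subset`). Otherwise some
coordinate has low average degree. The tree queries it and restricts to a rectangle with the answer
as gadget value, found by hitting (`Thick.exists_query`). Deleting this coordinate raises the
density of `A × B` by at least `1 / (4φ) ≥ G`.

Density starts at 1 and never exceeds 1, so `G ^ queries ≤ 4 ^ bits`. At a leaf thickness still
permits every string of gadget values on `I` (`Thick.exists_gadget_values`), so the protocol's
output is correct for every `z` that leads there. With `G = 2^(n/400)`, logarithms give the theorem.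
-/

namespace Lifting

open Finset

/-! ### Concentration of measure on the Boolean cube. -/

/-- Concentration of measure on the cube: an upper bound `d` for the distance to `X` that has a small
exponential moment. -/
theorem exists_dist_exp_moment {q : ℝ} (hq : 1 ≤ q) (n : ℕ) (X : Finset (Fin n → Bool))
    (hX : X.Nonempty) :
    ∃ d : (Fin n → Bool) → ℕ, (∀ c, ∃ x ∈ X, hammingDist c x ≤ d c) ∧
      (∑ c, q ^ d c) * (#X : ℝ) ≤ (2 + q + q⁻¹) ^ n := by
  have hq0 : 0 < q := by linarith
  induction n with
  | zero =>
    obtain ⟨x, hx⟩ := hX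
    refine ⟨fun _ => 0, fun c => ⟨x, hx, by simp [Subsingleton.elim c x]⟩, ?_⟩
    have : #X ≤ 1 := by simpa using X.card_le_univ
    simpa using this
  | succ n ih =>
    let Y (b : Bool) : Finset (Fin n → Bool) := {x | (Fin.cons b x : Fin (n + 1) → Bool) ∈ X}
    have hdist (b b' : Bool) (x y : Fin n → Bool) :
        hammingDist (Fin.cons b x : Fin (n + 1) → Bool) (Fin.cons b' y) =
          (if b = b' then 0 else 1) + hammingDist x y := by
      simp only [hammingDist, Finset.card_filter, Fin.sum_univ_succ, Fin.cons_zero, Fin.cons_succ]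
      split_ifs <;> simp_all
    have hsum (F : (Fin (n + 1) → Bool) → ℝ) :
        ∑ c, F c = ∑ x, F (Fin.cons true x) + ∑ x, F (Fin.cons false x) := by
      rw [← (Fin.consEquiv fun _ => Bool).sum_comp, Fintype.sum_prod_type]
      simp [Fin.consEquiv]
    have hcard : (#X : ℝ) = #(Y true) + #(Y false) := by
      have := hsum fun c => if c ∈ X then 1 else 0
      simpa [Y, Finset.sum_boole] using this
    set K : ℝ := (2 + q + q⁻¹) ^ n with hK
    have hK0 : 0 ≤ K := by positivity
    have hKs : (2 + q + q⁻¹) ^ (n + 1) = K * ((1 + q) * (1 + q⁻¹)) := by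
      rw [pow_succ, hK]; field_simp; ring
    -- Unbalanced sections: always go to the larger section, paying 1 when the first coordinate must
    -- be flipped. The moment grows by `1 + q`, the set by at most `1 + q⁻¹`.
    have hlow (b : Bool) (h0 : (Y b).Nonempty) (h : (#(Y !b) : ℝ) * q ≤ #(Y b)) :
        ∃ d : (Fin (n + 1) → Bool) → ℕ, (∀ c, ∃ x ∈ X, hammingDist c x ≤ d c) ∧
          (∑ c, q ^ d c) * (#X : ℝ) ≤ (2 + q + q⁻¹) ^ (n + 1) := by
      obtain ⟨d, hd, hs⟩ := ih (Y b) h0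
      refine ⟨fun c => (if c 0 = b then 0 else 1) + d (Fin.tail c), fun c => ?_, ?_⟩
      · obtain ⟨x, hx, hxd⟩ := hd (Fin.tail c)
        refine ⟨Fin.cons b x, by simpa [Y] using hx, ?_⟩
        rw [← Fin.cons_self_tail c, hdist]
        simpa using hxd
      · have h1 : ∑ c : Fin (n + 1) → Bool, q ^ ((if c 0 = b then 0 else 1) + d (Fin.tail c)) =
            (1 + q) * ∑ x, q ^ d x := by
          rw [hsum]
          cases b <;> simp [pow_add, ← Finset.mul_sum] <;> ring
        have h2 : (#X : ℝ) ≤ (1 + q⁻¹) * #(Y b) := by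
          have : (#(Y !b) : ℝ) ≤ q⁻¹ * #(Y b) := by
            rw [inv_mul_eq_div, le_div_iff₀ hq0]; exact h
          have h3 : (#X : ℝ) = #(Y b) + #(Y !b) := by
            rw [hcard]; cases b <;> simp [add_comm]
          linarith
        have h4 : 0 ≤ ∑ x, q ^ d x := by positivity
        rw [h1, hKs]
        calc (1 + q) * (∑ x, q ^ d x) * (#X : ℝ)
            ≤ (1 + q) * (∑ x, q ^ d x) * ((1 + q⁻¹) * #(Y b)) := by gcongr
          _ = ((∑ x, q ^ d x) * #(Y b)) * ((1 + q) * (1 + q⁻¹)) := by ring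
          _ ≤ _ := by gcongr
    have hXpos : (0 : ℝ) < #X := by exact_mod_cast hX.card_pos
    have hne (b : Bool) (h : (0 : ℝ) < #(Y b)) : (Y b).Nonempty :=
      Finset.card_pos.1 (by exact_mod_cast h)
    have hnn (b : Bool) : (0 : ℝ) ≤ #(Y b) := by positivity
    by_cases ht : (#(Y false) : ℝ) * q ≤ #(Y true)
    · refine hlow true (hne _ ?_) ht
      nlinarith [hnn true, hnn false]
    by_cases hf : (#(Y true) : ℝ) * q ≤ #(Y false)
    · refine hlow false (hne _ ?_) hf
      nlinarith [hnn true, hnn false]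
    push Not at ht hf
    have hpt : (0 : ℝ) < #(Y true) := by
      by_contra h
      nlinarith [hnn true, hnn false]
    have hpf : (0 : ℝ) < #(Y false) := by
      by_contra h
      nlinarith [hnn true, hnn false]
    -- Balanced sections: each point stays in the section of its own first coordinate.
    have hd (b : Bool) := ih (Y b) (hne b (by cases b <;> assumption))
    choose d hd hs using hd
    refine ⟨fun c => d (c 0) (Fin.tail c), fun c => ?_, ?_⟩
    · obtain ⟨x, hx, hxd⟩ := hd (c 0) (Fin.tail c)
      refine ⟨Fin.cons (c 0) x, by simpa [Y] using hx, ?_⟩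
      conv_lhs => rw [← Fin.cons_self_tail c]
      rw [hdist]
      simpa using hxd
    · have ht' := hs true
      have hf' := hs false
      rw [hsum, hcard, hKs]
      simp only [Fin.cons_zero, Fin.tail_cons]
      set u : ℝ := ((#(Y true) : ℕ) : ℝ)
      set v : ℝ := ((#(Y false) : ℕ) : ℝ)
      rw [← le_div_iff₀ hpt] at ht'
      rw [← le_div_iff₀ hpf] at hf'
      -- Both factors are negative. Expanded, this is `q (u + v)² ≤ (1 + q)² u v`, exactly the
      -- growth allowed.
      have key : (u - v * q) * (v - u * q) ≥ 0 := by nlinarith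
      calc _ ≤ (K / u + K / v) * (u + v) := by gcongr
        _ = K * ((u + v) ^ 2 / (u * v)) := by field_simp; ring
        _ ≤ _ := by
          gcongr
          rw [div_le_iff₀ (by positivity)]
          have : (1 + q) * (1 + q⁻¹) * (u * v) = (1 + q) ^ 2 * (u * v) / q := by
            field_simp; ring
          rw [this, le_div_iff₀ hq0]
          nlinarith

/-! ### Hitting rectangles for gap-Hamming. -/

/-- The rectangles `U c × V c` are monochromatic for the value `b` of the gadget `g`, and a random one
meets every large set of rows, and every large set of columns, with probability at least `3/4`. -/
def HittingRectangles {α : Type} [Fintype α] (g : α → α → Option Bool) (m : ℝ) (b : Bool)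
    (U V : α → Finset α) : Prop :=
  (∀ c, ∀ x ∈ U c, ∀ y ∈ V c, g x y = some b) ∧
    ∀ X : Finset α, m ≤ #X →
      4 * Nat.card {c // Disjoint (U c) X} ≤ Fintype.card α ∧
      4 * Nat.card {c // Disjoint (V c) X} ≤ Fintype.card α

/-- The Hamming ball of radius `n / 8`. -/
def eighthBall {n : ℕ} (c : Fin n → Bool) : Finset (Fin n → Bool) := {x | 8 * hammingDist c x ≤ n}

/-- A centre whose ball misses `X` has distance more than `n / 8` from it, so Markov's inequality
applied to the exponential moment bounds the number of such centres. -/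
theorem card_disjoint_eighthBall_le {n : ℕ} (hn : 200 ≤ n) (X : Finset (Fin n → Bool))
    (hX : (2 : ℝ) ^ n * (1000 / 1007) ^ n ≤ #X) :
    4 * Nat.card {c : Fin n → Bool // Disjoint (eighthBall c) X} ≤ Fintype.card (Fin n → Bool) := by
  classical
  have hX0 : (0 : ℝ) < #X := lt_of_lt_of_le (by positivity) hX
  -- The eighth power makes `q ^ d ≥ (257/250) ^ n` as soon as `8 d ≥ n`, and `2 + q + q⁻¹` is at
  -- most `81/20`, barely above 4.
  obtain ⟨d, hd, hs⟩ := exists_dist_exp_moment (q := (257 / 250) ^ 8) (by norm_num) n X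
    (Finset.card_pos.1 (by exact_mod_cast hX0))
  set S : Finset (Fin n → Bool) := {c | Disjoint (eighthBall c) X} with hS
  have hcard : Nat.card {c : Fin n → Bool // Disjoint (eighthBall c) X} = #S := by
    rw [Nat.card_eq_fintype_card, Fintype.card_subtype]
  have h1 : (#S : ℝ) * (257 / 250) ^ n ≤ ∑ c, ((257 / 250 : ℝ) ^ 8) ^ d c := by
    calc (#S : ℝ) * (257 / 250) ^ n = ∑ c ∈ S, (257 / 250 : ℝ) ^ n := by simp
      _ ≤ ∑ c ∈ S, ((257 / 250 : ℝ) ^ 8) ^ d c := by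
        refine Finset.sum_le_sum fun c hc => ?_
        rw [← pow_mul]
        refine pow_le_pow_right₀ (by norm_num) ?_
        obtain ⟨x, hx, hxd⟩ := hd c
        have hc : Disjoint (eighthBall c) X := by simpa [hS] using hc
        have : ¬ 8 * hammingDist c x ≤ n := fun h =>
          Finset.disjoint_left.1 hc (by simpa [eighthBall] using h) hx
        omega
      _ ≤ _ := Finset.sum_le_univ_sum_of_nonneg fun c => by positivity
  have h2 : (#S : ℝ) * (257 / 250) ^ n * (2 ^ n * (1000 / 1007) ^ n) ≤ (81 / 20) ^ n :=
    calc _ ≤ (∑ c, ((257 / 250 : ℝ) ^ 8) ^ d c) * #X := by gcongr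
      _ ≤ _ := hs
      _ ≤ _ := by gcongr; norm_num
  have h3 : (#S : ℝ) ≤ 2 ^ n * (124 / 125) ^ n := by
    have e : (2 : ℝ) ^ n * (124 / 125) ^ n * ((257 / 250) ^ n * (2 ^ n * (1000 / 1007) ^ n)) ≥
        (81 / 20) ^ n := by
      simp only [← mul_pow]
      gcongr
      norm_num
    have : (0 : ℝ) < (257 / 250) ^ n * (2 ^ n * (1000 / 1007) ^ n) := by positivity
    refine le_of_mul_le_mul_right ?_ this
    linarith
  have h4 : (124 / 125 : ℝ) ^ n ≤ 1 / 4 :=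
    (pow_le_pow_of_le_one (by norm_num) (by norm_num) hn).trans (by norm_num)
  have h5 : (4 : ℝ) * #S ≤ 2 ^ n := by
    have : (2 : ℝ) ^ n * (124 / 125) ^ n ≤ 2 ^ n * (1 / 4) := by gcongr
    linarith
  rw [hcard]
  simp only [Fintype.card_pi, Fintype.card_bool, Finset.prod_const, Finset.card_univ,
    Fintype.card_fin]
  exact_mod_cast h5

theorem hammingDist_not_add {n : ℕ} (x y : Fin n → Bool) :
    hammingDist x (fun i => !y i) + hammingDist x y = n := by
  have h := Finset.card_filter_add_card_filter_not (s := (univ : Finset (Fin n)))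
    (fun i => x i ≠ y i)
  simp only [Finset.card_univ, Fintype.card_fin] at h
  have e : hammingDist x (fun i => !y i) = #{i | ¬ x i ≠ y i} := by
    unfold hammingDist
    congr 1
    ext i
    cases hx : x i <;> cases hy : y i <;> simp [hx, hy]
  rw [e, add_comm]
  exact h

theorem GH_eq_some_false {n : ℕ} (hn : 0 < n) {x y : Fin n → Bool} (h : 4 * hammingDist x y ≤ n) :
    GH n (1 / 4) x y = some false := by
  have hn' : (0 : ℝ) < n := by exact_mod_cast hn
  have h' : (4 : ℝ) * hammingDist x y ≤ n := by exact_mod_cast h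
  rw [GH, if_neg (by push Not; linarith), if_pos (by linarith)]

theorem GH_eq_some_true {n : ℕ} {x y : Fin n → Bool} (h : 3 * n ≤ 4 * hammingDist x y) :
    GH n (1 / 4) x y = some true := by
  have h' : (3 : ℝ) * n ≤ 4 * hammingDist x y := by exact_mod_cast h
  rw [GH, if_pos (by linarith)]

theorem exists_hittingRectangles_GH {n : ℕ} (hn : 200 ≤ n) (b : Bool) :
    ∃ U V, HittingRectangles (GH n (1 / 4)) ((2 : ℝ) ^ n * (1000 / 1007) ^ n) b U V := by
  have tri (c x y : Fin n → Bool) (hx : x ∈ eighthBall c) (hy : y ∈ eighthBall c) :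
      4 * hammingDist x y ≤ n := by
    simp only [eighthBall, Finset.mem_filter, Finset.mem_univ, true_and] at hx hy
    have := hammingDist_triangle x c y
    rw [hammingDist_comm x c] at this
    omega
  cases b with
  | false =>
    exact ⟨eighthBall, eighthBall, fun c x hx y hy => GH_eq_some_false (by omega) (tri c x y hx hy),
      fun X hX => ⟨card_disjoint_eighthBall_le hn X hX, card_disjoint_eighthBall_le hn X hX⟩⟩
  | true =>
    -- For value 1 the balls have antipodal centres: complementing `y` reduces to the case of equal
    -- centres.
    refine ⟨eighthBall, fun c => eighthBall fun i => !c i, fun c x hx y hy => ?_, fun X hX =>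
      ⟨card_disjoint_eighthBall_le hn X hX, ?_⟩⟩
    · have hy' : (fun i => !y i) ∈ eighthBall c := by
        have h1 := hammingDist_not_add y c
        have h2 := hammingDist_not_add c y
        simp only [eighthBall, Finset.mem_filter, Finset.mem_univ, true_and] at hy ⊢
        rw [hammingDist_comm y c] at h1
        rw [hammingDist_comm] at hy
        omega
      have h1 := tri c x _ hx hy'
      have h2 := hammingDist_not_add x y
      exact GH_eq_some_true (by omega)
    · let e : (Fin n → Bool) ≃ (Fin n → Bool) :=
        ⟨fun c i => !c i, fun c i => !c i, fun c => by simp, fun c => by simp⟩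
      have : Nat.card {c : Fin n → Bool // Disjoint (eighthBall fun i => !c i) X} =
          Nat.card {c : Fin n → Bool // Disjoint (eighthBall c) X} :=
        Nat.card_congr (e.subtypeEquiv fun c => Iff.rfl)
      rw [this]
      exact card_disjoint_eighthBall_le hn X hX

/-! ### Thick sets: pruning, and restriction at a queried coordinate. -/

section Thickness

variable {p : ℕ} {α : Type}

theorem restrict_eq_iff {J : Finset (Fin p)} {a a' : Fin p → α} :
    J.restrict a = J.restrict a' ↔ ∀ j ∈ J, a j = a' j := by
  simp [funext_iff]

theorem exists_two_mul_card_filter_ge (s : (Fin p → α) → Bool) (A : Finset (Fin p → α)) :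
    ∃ v, #A ≤ 2 * #{a ∈ A | s a = v} := by
  have h := Finset.card_filter_add_card_filter_not (s := A) (fun a => s a = true)
  simp only [Bool.not_eq_true] at h
  by_contra! hv
  have h0 := hv false
  have h1 := hv true
  omega

/-- Markov's inequality and a union bound: average relative shortfalls of at most 1/4 cannot force a
shortfall above 1/2 in `e` or `f` at every `c`. -/
theorem exists_two_mul_le {κ : Type} [Fintype κ] [Nonempty κ] {v w : ℕ} (hv : 0 < v) (hw : 0 < w)
    {e f : κ → ℕ} (he : 4 * ∑ c, (v - e c) ≤ v * Fintype.card κ)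
    (hf : 4 * ∑ c, (w - f c) ≤ w * Fintype.card κ) : ∃ c, v ≤ 2 * e c ∧ w ≤ 2 * f c := by
  by_contra! h
  have h1 : ∑ _c : κ, v * w < ∑ c, (2 * (v - e c) * w + 2 * (w - f c) * v) := by
    refine Finset.sum_lt_sum_of_nonempty Finset.univ_nonempty fun c _ => ?_
    rcases lt_or_ge (2 * e c) v with h' | h'
    · have : v < 2 * (v - e c) := by omega
      nlinarith
    · have := h c h'
      have : w < 2 * (w - f c) := by omega
      nlinarith
  rw [Finset.sum_add_distrib, ← Finset.sum_mul (f := fun c => 2 * (v - e c)),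
    ← Finset.sum_mul (f := fun c => 2 * (w - f c)),
    ← Finset.mul_sum (f := fun c => v - e c), ← Finset.mul_sum (f := fun c => w - f c), Finset.sum_const, Finset.card_univ, smul_eq_mul] at h1
  nlinarith

theorem restrict_eq_of_erase {I : Finset (Fin p)} {i : Fin p} {a a' : Fin p → α} (hi : a i = a' i)
    (h : (I.erase i).restrict a = (I.erase i).restrict a') : I.restrict a = I.restrict a' := by
  rw [restrict_eq_iff] at h ⊢
  intro j hj
  by_cases hji : j = i
  · rw [hji, hi]
  · exact h j (Finset.mem_erase.2 ⟨hji, hj⟩)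

variable [DecidableEq α]

/-- The projection of `A` to the coordinates in `J`. -/
abbrev proj (J : Finset (Fin p)) (A : Finset (Fin p → α)) : Finset (J → α) := A.image J.restrict

/-- A nonempty set that is determined by its coordinates in `I`, and in whose projection to these
coordinates every element has at least `m` neighbours in each direction. -/
structure Thick (m : ℝ) (I : Finset (Fin p)) (A : Finset (Fin p → α)) : Prop where
  nonempty : A.Nonempty
  injOn : Set.InjOn I.restrict (A : Set (Fin p → α))
  le_degree : ∀ i ∈ I, ∀ a ∈ A, m ≤ #{a' ∈ A | (I.erase i).restrict a' = (I.erase i).restrict a}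

/-- Removing the elements of low degree, one neighbourhood after the other. -/
theorem exists_subset_le_degree {m : ℝ} (hm : 0 ≤ m) (I : Finset (Fin p))
    (A : Finset (Fin p → α)) :
    ∃ A' ⊆ A, (∀ i ∈ I, ∀ a ∈ A', m ≤ #{a' ∈ A' | (I.erase i).restrict a' = (I.erase i).restrict a}) ∧
      (#A : ℝ) + m * ∑ i ∈ I, (#(proj (I.erase i) A') : ℝ) ≤
        #A' + m * ∑ i ∈ I, (#(proj (I.erase i) A) : ℝ) := by
  induction A using Finset.strongInduction with
  | H A ih =>
    by_cases h : ∀ i ∈ I, ∀ a ∈ A, m ≤ #{a' ∈ A | (I.erase i).restrict a' = (I.erase i).restrict a}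
    · exact ⟨A, Subset.rfl, h, le_rfl⟩
    push Not at h
    obtain ⟨i, hi, a, ha, hlt⟩ := h
    set S := {a' ∈ A | (I.erase i).restrict a' = (I.erase i).restrict a} with hS
    have haS : a ∈ S := by simp [hS, ha]
    have hSA : S ⊆ A := Finset.filter_subset _ _
    obtain ⟨A', hA', hdeg, hle⟩ := ih (A \ S) (Finset.sdiff_ssubset hSA ⟨a, haS⟩)
    refine ⟨A', hA'.trans Finset.sdiff_subset, hdeg, ?_⟩
    have hc : (#A : ℝ) = #(A \ S) + #S := by
      exact_mod_cast (Finset.card_sdiff_add_card_eq_card hSA).symm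
    -- Removing a fibre loses fewer than `m` elements but at least one point of a projection, so `#A
    -- - m * ∑ #proj` does not decrease.
    have hsum : (∑ j ∈ I, (#(proj (I.erase j) (A \ S)) : ℝ)) + 1 ≤
        ∑ j ∈ I, (#(proj (I.erase j) A) : ℝ) := by
      rw [← Finset.add_sum_erase I _ hi, ← Finset.add_sum_erase I _ hi]
      have h1 : (#(proj (I.erase i) (A \ S)) : ℝ) + 1 ≤ #(proj (I.erase i) A) := by
        have : proj (I.erase i) (A \ S) ⊂ proj (I.erase i) A := by
          refine Finset.ssubset_iff_subset_ne.2 ⟨Finset.image_subset_image Finset.sdiff_subset,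
            fun he => ?_⟩
          have : (I.erase i).restrict a ∈ proj (I.erase i) (A \ S) :=
            he ▸ Finset.mem_image_of_mem _ ha
          obtain ⟨a', ha', hr⟩ := Finset.mem_image.1 this
          rw [Finset.mem_sdiff] at ha'
          exact ha'.2 (Finset.mem_filter.2 ⟨ha'.1, hr⟩)
        exact_mod_cast Finset.card_lt_card this
      have h2 : ∑ j ∈ I.erase i, (#(proj (I.erase j) (A \ S)) : ℝ) ≤
          ∑ j ∈ I.erase i, (#(proj (I.erase j) A) : ℝ) :=
        Finset.sum_le_sum fun j _ => by
          exact_mod_cast Finset.card_le_card (Finset.image_subset_image Finset.sdiff_subset)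
      linarith
    nlinarith

/-- Pruning removes at most `m` elements per point of the projections. Average degree at least `L ≥
4 * #I * m` limits this total to a quarter of `A`, so at least a quarter of `A` survives from the
half in `S`. -/
theorem Thick.exists_subset {m L : ℝ} (hm : 0 ≤ m) {I : Finset (Fin p)} {A S : Finset (Fin p → α)}
    (hA : Thick m I A) (hL : 4 * (#I * m) ≤ L)
    (hdeg : ∀ i ∈ I, L * #(proj (I.erase i) A) ≤ #A) (hSA : S ⊆ A) (hS : #A ≤ 2 * #S) :
    ∃ A' ⊆ S, Thick m I A' ∧ (#A : ℝ) ≤ 4 * #A' := by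
  obtain ⟨A', hA', hdeg', hle⟩ := exists_subset_le_degree hm I S
  have hpos : (0 : ℝ) < #A := by exact_mod_cast hA.nonempty.card_pos
  have hsum : 4 * (m * ∑ i ∈ I, (#(proj (I.erase i) S) : ℝ)) ≤ #A := by
    rw [Finset.mul_sum, Finset.mul_sum]
    have : ∀ i ∈ I, 4 * (m * (#(proj (I.erase i) S) : ℝ)) ≤ #A / #I := by
      intro i hi
      have hI : (0 : ℝ) < #I := by exact_mod_cast Finset.card_pos.2 ⟨i, hi⟩
      have h1 : (#(proj (I.erase i) S) : ℝ) ≤ #(proj (I.erase i) A) := by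
        exact_mod_cast Finset.card_le_card (Finset.image_subset_image hSA)
      rw [le_div_iff₀ hI]
      calc 4 * (m * (#(proj (I.erase i) S) : ℝ)) * #I
          = 4 * (#I * m) * #(proj (I.erase i) S) := by ring
        _ ≤ L * #(proj (I.erase i) A) := by
          apply mul_le_mul hL h1 (by positivity)
          exact le_trans (by positivity) hL
        _ ≤ #A := hdeg i hi
    have h2 := Finset.sum_le_card_nsmul I _ _ this
    rw [nsmul_eq_mul] at h2
    refine h2.trans ?_
    rcases I.eq_empty_or_nonempty with h | h
    · simp [h]
    · have hI : (#I : ℝ) ≠ 0 := by exact_mod_cast h.card_pos.ne'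
      rw [mul_div_cancel₀ _ hI]
  have hS' : (#A : ℝ) ≤ 2 * #S := by exact_mod_cast hS
  have h0 : 0 ≤ m * ∑ i ∈ I, (#(proj (I.erase i) A') : ℝ) := by positivity
  have hfin : (#A : ℝ) ≤ 4 * #A' := by linarith
  refine ⟨A', hA', ⟨?_, ?_, hdeg'⟩, hfin⟩
  · have : (0 : ℝ) < #A' := by linarith
    exact Finset.card_pos.1 (by exact_mod_cast this)
  · exact hA.injOn.mono (by exact_mod_cast hA'.trans hSA)

/-- Keeping one representative per point of the projection makes the remaining coordinates determine
the element. Degrees do not drop, because neighbours in a direction `j ≠ i` share coordinate `i` and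
so lie over `U` together. -/
theorem Thick.exists_subset_erase {m : ℝ} {I : Finset (Fin p)} {A : Finset (Fin p → α)}
    (hA : Thick m I A) {i : Fin p} (hi : i ∈ I) (U : Finset α) (hU : ∃ a ∈ A, a i ∈ U) :
    ∃ A' ⊆ A, (∀ a ∈ A', a i ∈ U) ∧ Thick m (I.erase i) A' ∧
      #A' = #(proj (I.erase i) {a ∈ A | a i ∈ U}) := by
  obtain ⟨A', hA', hinj, himg⟩ := Finset.exists_subset_injOn_image_eq_of_surjOn
    (f := (I.erase i).restrict (π := fun _ => α)) ({a ∈ A | a i ∈ U} : Finset (Fin p → α))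
    (proj (I.erase i) {a ∈ A | a i ∈ U})
    (by rw [Finset.coe_image]; exact Set.surjOn_image _ _)
  have hmem : ∀ a ∈ A', a ∈ A ∧ a i ∈ U := fun a ha => by simpa using hA' ha
  refine ⟨A', fun a ha => (hmem a ha).1, fun a ha => (hmem a ha).2, ⟨?_, hinj, ?_⟩, ?_⟩
  · obtain ⟨a, ha, haU⟩ := hU
    rw [← Finset.image_nonempty (f := (I.erase i).restrict), himg]
    exact ⟨_, Finset.mem_image_of_mem _ (Finset.mem_filter.2 ⟨ha, haU⟩)⟩
  · intro j hj a ha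
    have hji := Finset.ne_of_mem_erase hj
    refine (hA.le_degree j (Finset.mem_of_mem_erase hj) a (hmem a ha).1).trans ?_
    have hrep : ∀ x ∈ A, x i ∈ U → ∃ y ∈ A', (I.erase i).restrict y = (I.erase i).restrict x := by
      intro x hx hxU
      have : (I.erase i).restrict x ∈ A'.image (I.erase i).restrict := by
        rw [himg]
        exact Finset.mem_image_of_mem _ (Finset.mem_filter.2 ⟨hx, hxU⟩)
      simpa only [Finset.mem_image] using this
    choose! r hrA hr using hrep
    have hx : ∀ x ∈ ({a' ∈ A | (I.erase j).restrict a' = (I.erase j).restrict a} :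
        Finset (Fin p → α)), x ∈ A ∧ x i ∈ U ∧ ∀ k ∈ I.erase j, x k = a k := by
      intro x hx
      obtain ⟨hxA, hxr⟩ := Finset.mem_filter.1 hx
      rw [restrict_eq_iff] at hxr
      exact ⟨hxA, by rw [hxr i (Finset.mem_erase.2 ⟨hji.symm, hi⟩)]; exact (hmem a ha).2, hxr⟩
    norm_cast
    refine Finset.card_le_card_of_injOn r (fun x hxm => ?_) fun x hxm y hym hxy => ?_
    · obtain ⟨hxA, hxU, hxa⟩ := hx x hxm
      have h1 := restrict_eq_iff.1 (hr x hxA hxU)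
      refine Finset.mem_filter.2 ⟨hrA x hxA hxU, restrict_eq_iff.2 fun k hk => ?_⟩
      rw [Finset.mem_erase, Finset.mem_erase] at hk
      rw [h1 k (Finset.mem_erase.2 hk.2), hxa k (Finset.mem_erase.2 ⟨hk.1, hk.2.2⟩)]
    · obtain ⟨hxA, hxU, hxa⟩ := hx x hxm
      obtain ⟨hyA, hyU, hya⟩ := hx y hym
      have h1 := hr x hxA hxU
      have h2 := hr y hyA hyU
      rw [hxy] at h1
      refine hA.injOn hxA hyA (restrict_eq_of_erase (i := i) ?_ (h1.symm.trans h2))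
      have hik : i ∈ I.erase j := Finset.mem_erase.2 ⟨hji.symm, hi⟩
      rw [hxa i hik, hya i hik]
  · rw [← himg, Finset.card_image_of_injOn hinj]

variable [Fintype α]

theorem Thick.card_le_pow {m : ℝ} {I : Finset (Fin p)} {A : Finset (Fin p → α)}
    (hA : Thick m I A) : #A ≤ Fintype.card α ^ #I := by
  rw [← Finset.card_image_of_injOn hA.injOn]
  refine (Finset.card_le_univ _).trans ?_
  simp

theorem Thick.card_le_mul_proj {m : ℝ} {I : Finset (Fin p)} {A : Finset (Fin p → α)}
    (hA : Thick m I A) (i : Fin p) : #A ≤ Fintype.card α * #(proj (I.erase i) A) := by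
  refine Finset.card_le_mul_card_image _ _ fun w _ => ?_
  refine Finset.card_le_card_of_injOn (t := univ) (fun a => a i) (fun _ _ => Finset.mem_univ _) ?_
  intro a ha b hb hab
  simp only [Finset.coe_filter, Set.mem_ofPred_eq] at ha hb
  exact hA.injOn ha.1 hb.1 (restrict_eq_of_erase hab (ha.2.trans hb.2.symm))

/-- On average, few elements of a projection have no preimage whose coordinate `i` lies in `U c`. -/
theorem Thick.sum_card_missed_le {m : ℝ} {I : Finset (Fin p)} {A : Finset (Fin p → α)}
    (hA : Thick m I A) {i : Fin p} (hi : i ∈ I) {U : α → Finset α}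
    (hU : ∀ X : Finset α, m ≤ #X → 4 * Nat.card {c // Disjoint (U c) X} ≤ Fintype.card α) :
    4 * ∑ c, (#(proj (I.erase i) A) - #(proj (I.erase i) {a ∈ A | a i ∈ U c})) ≤
      #(proj (I.erase i) A) * Fintype.card α := by
  -- The values at `i` of the elements over `w`. Thickness gives at least `m` of them, so `U c`
  -- misses them for at most a quarter of the `c`; double counting finishes.
  let X (w : {j // j ∈ I.erase i} → α) : Finset α :=
    {a ∈ A | (I.erase i).restrict a = w}.image fun a => a i
  have h1 (c : α) : #(proj (I.erase i) A) - #(proj (I.erase i) {a ∈ A | a i ∈ U c}) ≤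
      #{w ∈ proj (I.erase i) A | Disjoint (U c) (X w)} := by
    refine (Finset.le_card_sdiff _ _).trans (Finset.card_le_card fun w hw => ?_)
    rw [Finset.mem_sdiff] at hw
    refine Finset.mem_filter.2 ⟨hw.1, Finset.disjoint_left.2 fun u hu hX => hw.2 ?_⟩
    obtain ⟨a, ha, rfl⟩ := Finset.mem_image.1 hX
    rw [Finset.mem_filter] at ha
    exact Finset.mem_image.2 ⟨a, Finset.mem_filter.2 ⟨ha.1, hu⟩, ha.2⟩
  have h2 (w) (hw : w ∈ proj (I.erase i) A) :
      4 * #{c | Disjoint (U c) (X w)} ≤ Fintype.card α := by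
    rw [← Fintype.card_subtype, ← Nat.card_eq_fintype_card]
    apply hU
    obtain ⟨a, ha, rfl⟩ := Finset.mem_image.1 hw
    refine (hA.le_degree i hi a ha).trans (le_of_eq ?_)
    rw [Finset.card_image_of_injOn]
    intro x hx y hy hxy
    simp only [Finset.coe_filter, Set.mem_ofPred_eq] at hx hy
    exact hA.injOn hx.1 hy.1 (restrict_eq_of_erase hxy (hx.2.trans hy.2.symm))
  calc _ ≤ 4 * ∑ c, #{w ∈ proj (I.erase i) A | Disjoint (U c) (X w)} := by
        gcongr with c; exact h1 c
    _ = ∑ w ∈ proj (I.erase i) A, 4 * #{c | Disjoint (U c) (X w)} := by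
        rw [← Finset.mul_sum]
        congr 1
        exact Finset.sum_card_bipartiteAbove_eq_sum_card_bipartiteBelow
          (s := univ) (t := proj (I.erase i) A) fun c w => Disjoint (U c) (X w)
    _ ≤ _ := by simpa using Finset.sum_le_card_nsmul _ _ _ h2

/-- By averaging, one `c` serves both sides: the rectangle `U c × V c` preserves at least half of
each projection. -/
theorem Thick.exists_query {m : ℝ} {I : Finset (Fin p)} {A B : Finset (Fin p → α)}
    (hA : Thick m I A) (hB : Thick m I B) {i : Fin p} (hi : i ∈ I) {g : α → α → Option Bool}
    {v : Bool} {U V : α → Finset α} (hUV : HittingRectangles g m v U V) :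
    ∃ A' ⊆ A, ∃ B' ⊆ B, Thick m (I.erase i) A' ∧ Thick m (I.erase i) B' ∧
      (∀ a ∈ A', ∀ b ∈ B', g (a i) (b i) = some v) ∧
      #(proj (I.erase i) A) ≤ 2 * #A' ∧ #(proj (I.erase i) B) ≤ 2 * #B' := by
  have : Nonempty α := ⟨hA.nonempty.choose i⟩
  have hpos {A : Finset (Fin p → α)} (h : A.Nonempty) : 0 < #(proj (I.erase i) A) :=
    (h.image _).card_pos
  obtain ⟨c, hcA, hcB⟩ := exists_two_mul_le (hpos hA.nonempty) (hpos hB.nonempty)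
    (hA.sum_card_missed_le hi fun X hX => (hUV.2 X hX).1)
    (hB.sum_card_missed_le hi fun X hX => (hUV.2 X hX).2)
  have hne {A : Finset (Fin p → α)} {W : Finset α} (h : A.Nonempty)
      (hc : #(proj (I.erase i) A) ≤ 2 * #(proj (I.erase i) {a ∈ A | a i ∈ W})) :
      ∃ a ∈ A, a i ∈ W := by
    have h1 : 0 < #(proj (I.erase i) {a ∈ A | a i ∈ W}) := by have := hpos h; omega
    obtain ⟨a, ha⟩ := Finset.image_nonempty.1 (Finset.card_pos.1 h1)
    exact ⟨a, by simpa using ha⟩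
  obtain ⟨A', hA', hAU, hAt, hAc⟩ := hA.exists_subset_erase hi (U c) (hne hA.nonempty hcA)
  obtain ⟨B', hB', hBV, hBt, hBc⟩ := hB.exists_subset_erase hi (V c) (hne hB.nonempty hcB)
  exact ⟨A', hA', B', hB', hAt, hBt, fun a ha b hb => hUV.1 c _ (hAU a ha) _ (hBV b hb),
    hAc ▸ hcA, hBc ▸ hcB⟩

end Thickness

/-! ### Simulation of a protocol by a decision tree. -/

section Simulation

variable {p : ℕ} {α : Type} [Fintype α]

/-- Some decision tree, of height bounded in terms of the height of `π` and the density of `A × B`,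
agrees with `π` on suitable inputs from `A × B` for every string of gadget values on `I`. -/
def Simulated {Z : Type} (g : α → α → Option Bool) (G : ℝ) (π : Protocol (Fin p → α) (Fin p → α) Z)
    (I : Finset (Fin p)) (A B : Finset (Fin p → α)) : Prop :=
  ∃ T : DecisionTree p Z,
    (∀ z, ∃ a ∈ A, ∃ b ∈ B, (∀ i ∈ I, g (a i) (b i) = some (z i)) ∧ π.eval a b = T.eval z) ∧
    (#A : ℝ) * #B * G ^ T.height ≤ 4 ^ π.height * ((Fintype.card α : ℝ) ^ #I) ^ 2

variable {Z : Type} {g : α → α → Option Bool} {m φ G : ℝ}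
  {π π₀ π₁ : Protocol (Fin p → α) (Fin p → α) Z} {I : Finset (Fin p)} {A B : Finset (Fin p → α)}

/-- The communication step: the factor 4 lost in density is paid for by the bit sent, and the
decision tree is unchanged. -/
theorem Simulated.of_subset (hG : 0 ≤ G) {A' B' : Finset (Fin p → α)} (hA : A' ⊆ A) (hB : B' ⊆ B)
    (hc : (#A : ℝ) * #B ≤ 4 * (#A' * #B')) (hh : π₀.height + 1 ≤ π.height)
    (he : ∀ a ∈ A', ∀ b ∈ B', π.eval a b = π₀.eval a b) (h : Simulated g G π₀ I A' B') :
    Simulated g G π I A B := by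
  obtain ⟨T, hT, hle⟩ := h
  refine ⟨T, fun z => ?_, ?_⟩
  · obtain ⟨a, ha, b, hb, h, h'⟩ := hT z
    exact ⟨a, hA ha, b, hB hb, h, (he a ha b hb).trans h'⟩
  · calc (#A : ℝ) * #B * G ^ T.height ≤ 4 * (#A' * #B') * G ^ T.height := by gcongr
      _ = 4 * (#A' * #B' * G ^ T.height) := by ring
      _ ≤ 4 * (4 ^ π₀.height * ((Fintype.card α : ℝ) ^ #I) ^ 2) := by gcongr
      _ = 4 ^ (π₀.height + 1) * ((Fintype.card α : ℝ) ^ #I) ^ 2 := by ring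
      _ ≤ _ := by gcongr; norm_num

variable [DecidableEq α]

/-- A thick rectangle contains inputs for every string of gadget values. -/
theorem Thick.exists_gadget_values {m : ℝ} {g : α → α → Option Bool}
    (hg : ∀ v, ∃ U V, HittingRectangles g m v U V) (z : Fin p → Bool) (I : Finset (Fin p)) :
    ∀ A B : Finset (Fin p → α), Thick m I A → Thick m I B →
      ∃ a ∈ A, ∃ b ∈ B, ∀ i ∈ I, g (a i) (b i) = some (z i) := by
  induction I using Finset.strongInduction with
  | H I ih =>
    intro A B hA hB
    rcases I.eq_empty_or_nonempty with rfl | ⟨i, hi⟩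
    · obtain ⟨a, ha⟩ := hA.nonempty
      obtain ⟨b, hb⟩ := hB.nonempty
      exact ⟨a, ha, b, hb, by simp⟩
    · obtain ⟨U, V, hUV⟩ := hg (z i)
      obtain ⟨A', hA', B', hB', hAt, hBt, hgv, -, -⟩ := hA.exists_query hB hi hUV
      obtain ⟨a, ha, b, hb, h⟩ := ih _ (Finset.erase_ssubset hi) A' B' hAt hBt
      refine ⟨a, hA' ha, b, hB' hb, fun j hj => ?_⟩
      by_cases hji : j = i
      · subst hji; exact hgv a ha b hb
      · exact h j (Finset.mem_erase.2 ⟨hji, hj⟩)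

/-- The query step keeps the protocol and drops `i` from `I`. Low average degree on one side gains a
factor `1 / φ` in density over the trivial bound; halving both projections loses 4, and `4 * φ * G ≤
1` leaves the `G` that pays for the query. -/
theorem Simulated.query (hφ : 0 ≤ φ) (hG : 0 ≤ G) (hφG : 4 * φ * G ≤ 1)
    (hg : ∀ v, ∃ U V, HittingRectangles g m v U V) (hA : Thick m I A) (hB : Thick m I B)
    {i : Fin p} (hi : i ∈ I)
    (hlow : (#A : ℝ) ≤ φ * Fintype.card α * #(proj (I.erase i) A) ∨
      (#B : ℝ) ≤ φ * Fintype.card α * #(proj (I.erase i) B))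
    (ih : ∀ A' B' : Finset (Fin p → α), Thick m (I.erase i) A' → Thick m (I.erase i) B' →
      Simulated g G π (I.erase i) A' B') : Simulated g G π I A B := by
  set N : ℝ := (Fintype.card α : ℝ) with hN
  have hN0 : 0 ≤ N := by positivity
  have hAB : (#A : ℝ) * #B ≤ φ * N ^ 2 * (#(proj (I.erase i) A) * #(proj (I.erase i) B)) := by
    have h1 : (#A : ℝ) ≤ N * #(proj (I.erase i) A) := by
      rw [hN]; exact_mod_cast hA.card_le_mul_proj i
    have h2 : (#B : ℝ) ≤ N * #(proj (I.erase i) B) := by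
      rw [hN]; exact_mod_cast hB.card_le_mul_proj i
    rcases hlow with h | h
    · calc _ ≤ (φ * N * #(proj (I.erase i) A)) * (N * #(proj (I.erase i) B)) := by gcongr
        _ = _ := by ring
    · calc _ ≤ (N * #(proj (I.erase i) A)) * (φ * N * #(proj (I.erase i) B)) := by gcongr
        _ = _ := by ring
  have hbranch (v : Bool) : ∃ T : DecisionTree p Z,
      (∀ z, z i = v → ∃ a ∈ A, ∃ b ∈ B,
        (∀ j ∈ I, g (a j) (b j) = some (z j)) ∧ π.eval a b = T.eval z) ∧
      (#A : ℝ) * #B * G ^ (T.height + 1) ≤ 4 ^ π.height * (N ^ #I) ^ 2 := by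
    obtain ⟨U, V, hUV⟩ := hg v
    obtain ⟨A', hA', B', hB', hAt, hBt, hgv, hcA, hcB⟩ := hA.exists_query hB hi hUV
    obtain ⟨T, hT, hle⟩ := ih A' B' hAt hBt
    refine ⟨T, fun z hz => ?_, ?_⟩
    · obtain ⟨a, ha, b, hb, h, he⟩ := hT z
      refine ⟨a, hA' ha, b, hB' hb, fun j hj => ?_, he⟩
      by_cases hji : j = i
      · subst hji; rw [hz]; exact hgv a ha b hb
      · exact h j (Finset.mem_erase.2 ⟨hji, hj⟩)
    · have hcA' : (#(proj (I.erase i) A) : ℝ) ≤ 2 * #A' := by exact_mod_cast hcA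
      have hcB' : (#(proj (I.erase i) B) : ℝ) ≤ 2 * #B' := by exact_mod_cast hcB
      have hI : N ^ #I = N * N ^ #(I.erase i) := by
        rw [← Finset.card_erase_add_one hi, pow_succ, mul_comm]
      calc (#A : ℝ) * #B * G ^ (T.height + 1)
          ≤ φ * N ^ 2 * ((2 * #A') * (2 * #B')) * G ^ (T.height + 1) := by
            refine mul_le_mul_of_nonneg_right (hAB.trans ?_) (by positivity)
            gcongr
        _ = 4 * φ * G * (N ^ 2 * (#A' * #B' * G ^ T.height)) := by ring
        _ ≤ 1 * (N ^ 2 * (4 ^ π.height * (N ^ #(I.erase i)) ^ 2)) := by gcongr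
        _ = _ := by rw [hI]; ring
  obtain ⟨T₀, hT₀, h₀⟩ := hbranch false
  obtain ⟨T₁, hT₁, h₁⟩ := hbranch true
  refine ⟨.query i T₀ T₁, fun z => ?_, ?_⟩
  · cases hz : z i with
    | false => simpa [DecisionTree.eval, hz] using hT₀ z hz
    | true => simpa [DecisionTree.eval, hz] using hT₁ z hz
  · rcases max_choice T₀.height T₁.height with h | h <;> simpa [DecisionTree.height, h]

/-- The simulation: if no coordinate has low average degree, then the decision tree follows the next
bit of the protocol, and otherwise it queries such a coordinate. -/
theorem Thick.simulated (hm : 0 ≤ m) (hφ : 0 ≤ φ) (hG : 0 ≤ G) (hφG : 4 * φ * G ≤ 1)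
    (hmφ : 4 * (p * m) ≤ φ * Fintype.card α) (hg : ∀ v, ∃ U V, HittingRectangles g m v U V)
    (π : Protocol (Fin p → α) (Fin p → α) Z) (I : Finset (Fin p)) :
    ∀ A B : Finset (Fin p → α), Thick m I A → Thick m I B → Simulated g G π I A B := by
  have hL (I : Finset (Fin p)) : 4 * (#I * m) ≤ φ * Fintype.card α := by
    have : (#I : ℝ) ≤ p := by exact_mod_cast (by simpa using I.card_le_univ)
    exact le_trans (by gcongr) hmφ
  induction π generalizing I with
  | leaf out =>
    intro A B hA hB
    refine ⟨.leaf out, fun z => ?_, ?_⟩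
    · obtain ⟨a, ha, b, hb, h⟩ := Thick.exists_gadget_values hg z I A B hA hB
      exact ⟨a, ha, b, hb, h, rfl⟩
    · have h1 : (#A : ℝ) ≤ (Fintype.card α : ℝ) ^ #I := by exact_mod_cast hA.card_le_pow
      have h2 : (#B : ℝ) ≤ (Fintype.card α : ℝ) ^ #I := by exact_mod_cast hB.card_le_pow
      simp only [DecisionTree.height, Protocol.height, pow_zero, mul_one, one_mul, sq]
      gcongr
  | alice s π₀ π₁ ih₀ ih₁ =>
    induction I using Finset.strongInduction with
    | H I ih =>
      intro A B hA hB
      -- Only the speaker's set shrinks, so only its average degrees need to be tested before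
      -- following a bit.
      by_cases hlow : ∃ i ∈ I, (#A : ℝ) ≤ φ * Fintype.card α * #(proj (I.erase i) A)
      · obtain ⟨i, hi, h⟩ := hlow
        exact Simulated.query hφ hG hφG hg hA hB hi (.inl h) (ih _ (Finset.erase_ssubset hi))
      push Not at hlow
      obtain ⟨v, hv⟩ := exists_two_mul_card_filter_ge s A
      obtain ⟨A', hA', hAt, hc⟩ := hA.exists_subset hm (hL I) (fun i hi => (hlow i hi).le)
        (Finset.filter_subset _ _) hv
      have hs : ∀ a ∈ A', s a = v := fun a ha => (Finset.mem_filter.1 (hA' ha)).2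
      have hc' : (#A : ℝ) * #B ≤ 4 * (#A' * #B) := by rw [← mul_assoc]; gcongr
      have hsub : A' ⊆ A := hA'.trans (Finset.filter_subset _ _)
      cases v with
      | false =>
        refine Simulated.of_subset hG hsub Subset.rfl hc' ?_ ?_ (ih₀ I A' B hAt hB)
        · simp [Protocol.height]
        · intro a ha b _; simp [Protocol.eval, hs a ha]
      | true =>
        refine Simulated.of_subset hG hsub Subset.rfl hc' ?_ ?_ (ih₁ I A' B hAt hB)
        · simp [Protocol.height]
        · intro a ha b _; simp [Protocol.eval, hs a ha]
  | bob s π₀ π₁ ih₀ ih₁ =>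
    induction I using Finset.strongInduction with
    | H I ih =>
      intro A B hA hB
      by_cases hlow : ∃ i ∈ I, (#B : ℝ) ≤ φ * Fintype.card α * #(proj (I.erase i) B)
      · obtain ⟨i, hi, h⟩ := hlow
        exact Simulated.query hφ hG hφG hg hA hB hi (.inr h) (ih _ (Finset.erase_ssubset hi))
      push Not at hlow
      obtain ⟨v, hv⟩ := exists_two_mul_card_filter_ge s B
      obtain ⟨B', hB', hBt, hc⟩ := hB.exists_subset hm (hL I) (fun i hi => (hlow i hi).le)
        (Finset.filter_subset _ _) hv
      have hs : ∀ b ∈ B', s b = v := fun b hb => (Finset.mem_filter.1 (hB' hb)).2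
      have hc' : (#A : ℝ) * #B ≤ 4 * (#A * #B') := by rw [mul_left_comm]; gcongr
      have hsub : B' ⊆ B := hB'.trans (Finset.filter_subset _ _)
      cases v with
      | false =>
        refine Simulated.of_subset hG Subset.rfl hsub hc' ?_ ?_ (ih₀ I A B' hA hBt)
        · simp [Protocol.height]
        · intro a _ b hb; simp [Protocol.eval, hs b hb]
      | true =>
        refine Simulated.of_subset hG Subset.rfl hsub hc' ?_ ?_ (ih₁ I A B' hA hBt)
        · simp [Protocol.height]
        · intro a _ b hb; simp [Protocol.eval, hs b hb]

theorem thick_univ [Nonempty α] (hm : m ≤ Fintype.card α) :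
    Thick m (univ : Finset (Fin p)) (univ : Finset (Fin p → α)) := by
  refine ⟨Finset.univ_nonempty, fun a _ b _ h => funext fun i => restrict_eq_iff.1 h i (mem_univ i),
    fun i _ a _ => hm.trans ?_⟩
  norm_cast
  refine Finset.card_le_card_of_injOn (s := univ) (fun x => Function.update a i x)
    (fun x _ => ?_) fun x _ y _ h => ?_
  · refine Finset.mem_filter.2 ⟨mem_univ _, restrict_eq_iff.2 fun j hj => ?_⟩
    exact Function.update_of_ne (Finset.ne_of_mem_erase hj) _ _
  · simpa using congrFun h i

/-- The simulation theorem for gadgets with hitting rectangles. -/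
theorem pow_Ddt_le_four_pow_Dcc [Nonempty α] [Nonempty Z] (hm : 0 ≤ m) (hφ : 0 ≤ φ) (hG : 1 ≤ G)
    (hφG : 4 * φ * G ≤ 1) (hmφ : 4 * (p * m) ≤ φ * Fintype.card α) (hmα : m ≤ Fintype.card α)
    (hg : ∀ v, ∃ U V, HittingRectangles g m v U V) (f : (Fin p → Bool) → Z) :
    G ^ Ddt f ≤ 4 ^ Dcc (compose f g) := by
  obtain ⟨π₀, hπ₀⟩ := Protocol.exists_computes (compose f g)
  obtain ⟨π, hπ, hh⟩ := Nat.sInf_mem (s := {c | ∃ π : Protocol (Fin p → α) (Fin p → α) Z,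
    π.Computes (compose f g) ∧ π.height = c}) ⟨_, π₀, hπ₀, rfl⟩
  obtain ⟨T, hT, hle⟩ := Thick.simulated hm hφ (by linarith) hφG hmφ hg π univ univ univ
    (thick_univ hmα) (thick_univ hmα)
  have hTf : T.Computes f := by
    intro z
    obtain ⟨a, -, b, -, h, he⟩ := hT z
    rw [← he]
    exact hπ a b _ ((compose_eq_some_iff _ _ _ _ _).2 ⟨z, fun i => h i (mem_univ i), rfl⟩)
  have hD : Ddt f ≤ T.height := Nat.sInf_le ⟨T, hTf, rfl⟩
  have hcc : Dcc (compose f g) = π.height := hh.symm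
  rw [hcc]
  refine (pow_le_pow_right₀ hG hD).trans ?_
  have hN : (0 : ℝ) < ((Fintype.card α : ℝ) ^ p) ^ 2 := by
    have : 0 < Fintype.card α := Fintype.card_pos
    positivity
  refine le_of_mul_le_mul_left ?_ hN
  simp only [Finset.card_univ, Fintype.card_pi, Finset.prod_const, Fintype.card_fin,
    Nat.cast_pow] at hle
  linarith

end Simulation

end Lifting

/-! ### Choice of parameters for gap-Hamming. -/

theorem mainTheorem5 :
    ∃ (C : ℝ) (N : ℕ), 0 < C ∧
      ∀ n : ℕ, N ≤ n → Even n →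
        ∀ p : ℕ, (p : ℝ) ≤ (2 : ℝ) ^ ((n : ℝ) / 200) →
          ∀ f : (Fin p → Bool) → Bool,
            (Lifting.Ddt f : ℝ) ≤
              C * (1 / (n : ℝ) * (Lifting.Dcc (Lifting.compose f (Lifting.GH n (1 / 4))) : ℝ)) := by
  -- The inequality `2^(n/400 * Ddt) ≤ 2^(2 * Dcc)` gives 800; `4φG ≤ 2^(4 - n/400)` must be at most
  -- 1, which gives 1600.
  refine ⟨800, 1600, by norm_num, fun n hn _ p hp f => ?_⟩
  have hn' : (1600 : ℝ) ≤ n := by exact_mod_cast hn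
  have hcard : (Fintype.card (Fin n → Bool) : ℝ) = 2 ^ n := by simp
  have h2 : (2 : ℝ) ^ ((n : ℝ) / 100) ≤ (1007 / 1000) ^ n := by
    have : (2 : ℝ) ^ ((1 : ℝ) / 100) ≤ 1007 / 1000 := by
      rw [one_div]
      refine (Real.rpow_inv_le_iff_of_pos (by norm_num) (by norm_num) (by norm_num)).2 ?_
      norm_num
    calc (2 : ℝ) ^ ((n : ℝ) / 100) = ((2 : ℝ) ^ ((1 : ℝ) / 100)) ^ n := by
          rw [← Real.rpow_natCast, ← Real.rpow_mul (by norm_num)]; congr 1; ring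
      _ ≤ _ := by gcongr
  have hinv : (1000 / 1007 : ℝ) ^ n ≤ 2 ^ (-((n : ℝ) / 100)) := by
    rw [Real.rpow_neg (by norm_num), show (1000 / 1007 : ℝ) = (1007 / 1000)⁻¹ by norm_num, inv_pow]
    exact inv_anti₀ (by positivity) h2
  -- `m` is the size at which the balls hit, and `φ` is what `4 p m ≤ φ 2^n` requires when `p ≤
  -- 2^(n/200)`.
  have key := Lifting.pow_Ddt_le_four_pow_Dcc (g := Lifting.GH n (1 / 4))
    (m := 2 ^ n * (1000 / 1007) ^ n) (φ := 4 * 2 ^ ((n : ℝ) / 200) * (1000 / 1007) ^ n)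
    (G := 2 ^ ((n : ℝ) / 400)) (by positivity) (by positivity)
    (Real.one_le_rpow (by norm_num) (by positivity)) ?_ ?_ ?_
    (Lifting.exists_hittingRectangles_GH (by omega)) f
  · have h4 : (4 : ℝ) = 2 ^ (2 : ℝ) := by norm_num
    rw [← Real.rpow_natCast, ← Real.rpow_natCast, h4, ← Real.rpow_mul (by norm_num),
      ← Real.rpow_mul (by norm_num), Real.rpow_le_rpow_left_iff (by norm_num)] at key
    have : (0 : ℝ) < n := by linarith
    rw [← mul_assoc, mul_one_div, div_mul_eq_mul_div, le_div_iff₀ this]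
    linarith
  · calc 4 * (4 * (2 : ℝ) ^ ((n : ℝ) / 200) * (1000 / 1007) ^ n) * 2 ^ ((n : ℝ) / 400)
        ≤ 4 * (4 * (2 : ℝ) ^ ((n : ℝ) / 200) * 2 ^ (-((n : ℝ) / 100))) * 2 ^ ((n : ℝ) / 400) := by
          gcongr
      _ = 2 ^ (4 : ℝ) * 2 ^ ((n : ℝ) / 200) * 2 ^ (-((n : ℝ) / 100)) * 2 ^ ((n : ℝ) / 400) := by
          rw [show (2 : ℝ) ^ (4 : ℝ) = 16 by norm_num]; ring
      _ = 2 ^ (4 - (n : ℝ) / 400) := by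
          rw [← Real.rpow_add (by norm_num), ← Real.rpow_add (by norm_num),
            ← Real.rpow_add (by norm_num)]
          congr 1; ring
      _ ≤ 1 := Real.rpow_le_one_of_one_le_of_nonpos (by norm_num) (by linarith)
  · rw [hcard]
    calc 4 * (p * ((2 : ℝ) ^ n * (1000 / 1007) ^ n))
        ≤ 4 * (2 ^ ((n : ℝ) / 200) * ((2 : ℝ) ^ n * (1000 / 1007) ^ n)) := by gcongr
      _ = _ := by ring
  · rw [hcard]
    exact mul_le_of_le_one_right (by positivity) (pow_le_one₀ (by norm_num) (by norm_num))
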